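/- Let $d\ge 1$, let $R\subset\mathbb{R}^d$ be a reduced (not necessarily crystallographic) root system, i.e. a finite set of nonzero vectors with $r_\alpha R=R$ and $R\cap\mathbb{R}\alpha=\{\pm\alpha\}$ for all $\alpha\in R$, where $r_\alpha$ is the reflection in the hyperplane $\alpha^\perp$. Let $R_+$ be a positive system of $R$, $G$ the group generated by the $r_\alpha$ ($\alpha\in R$), and $\kappa:R\to[0,\infty)$ a $G$-invariant function. Put $$\lambda_\kappa=\sum_{\alpha\in R_+}\kappa_\alpha+\frac{d-2}{2},\qquad h_\kappa(x)=\prod_{\alpha\in R_+}|\langle\alpha,x\rangle|^{\kappa_\alpha},\qquad b_\kappa=\Big(\int_{\mathbb{R}^d}h_\kappa(x)^2e^{-\|x\|^2/2}\,dx\Big)^{-1}.$$ For a polynomial $p$ on $\mathbb{R}^d$ (with real or complex coefficients) let $$\mathscr{D}_\xi p(x)=\partial_\xi p(x)+\sum_{\alpha\in R_+}\kappa_\alpha\langle\alpha,\xi\rangle\frac{p(x)-p(r_\alpha x)}{\langle\alpha,x\rangle}\quad(\xi\in\mathbb{R}^d),\qquad \Delta_\kappa=\sum_{j=1}^d\mathscr{D}_{e_j}^2,$$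 where the quotients are polynomials in $x$ and $e_1,\dots,e_d$ is the standard basis. Let $d\omega$ be the surface measure on the unit sphere $S^{d-1}$ induced from Lebesgue measure (counting measure if $d=1$). Then for every polynomial $p$ on $\mathbb{R}^d$, $$b_\kappa\int_{S^{d-1}}p(x)\,h_\kappa(x)^2\,d\omega(x)=\sum_{l=0}^\infty\frac{2^{-\lambda_\kappa}}{2^{2l}\,l!\,\Gamma(\lambda_\kappa+l+1)}\,(\Delta_\kappa^l p)(0).$$ In particular, if $\Delta_\kappa p=0$, then $$\Big(\int_{S^{d-1}}h_\kappa(x)^2\,d\omega(x)\Big)^{-1}\int_{S^{d-1}}p(x)\,h_\kappa(x)^2\,d\omega(x)=p(0).$$ -/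

import Mathlib

namespace DunklPizzetti

open MeasureTheory MvPolynomial

/-- Reduced (not necessarily crystallographic) root system in `ℝ^d`: a finite set of nonzero
vectors, stable under its own reflections, meeting each line `ℝα` at most in `±α`.
It is not required to span `ℝ^d`. -/
structure IsReducedRootSystem {d : ℕ} (R : Finset (EuclideanSpace ℝ (Fin d))) : Prop where
  ne_zero : ∀ α ∈ R, α ≠ 0
  reflection_mem : ∀ α ∈ R, ∀ β ∈ R, (Submodule.span ℝ {α})ᗮ.reflection β ∈ R
  reduced : ∀ α ∈ R, ∀ c : ℝ, c • α ∈ R → c = 1 ∨ c = -1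

/-- `Rpos` is a positive system of `R`: the roots lying strictly on one side of a hyperplane
that contains no root. -/
def IsPositiveSystem {d : ℕ} (R Rpos : Finset (EuclideanSpace ℝ (Fin d))) : Prop :=
  ∃ v : EuclideanSpace ℝ (Fin d), (∀ α ∈ R, inner ℝ α v ≠ 0) ∧
    ∀ α, α ∈ Rpos ↔ α ∈ R ∧ 0 < inner ℝ α v

/-- The reflection group `G` generated by the reflections `r_α`, `α ∈ R`. -/
noncomputable def reflectionGroup {d : ℕ} (R : Finset (EuclideanSpace ℝ (Fin d))) :
    Subgroup (EuclideanSpace ℝ (Fin d) ≃ₗᵢ[ℝ] EuclideanSpace ℝ (Fin d)) :=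
  Subgroup.closure {g | ∃ α ∈ R, g = (Submodule.span ℝ {α})ᗮ.reflection}

/-- Non-negative multiplicity function on `R`; the values of `κ` outside `R` play no role. -/
structure IsMultiplicityFunction {d : ℕ} (R : Finset (EuclideanSpace ℝ (Fin d)))
    (κ : EuclideanSpace ℝ (Fin d) → ℝ) : Prop where
  nonneg : ∀ α ∈ R, 0 ≤ κ α
  invariant : ∀ g ∈ reflectionGroup R, ∀ α ∈ R, κ (g α) = κ α

/-- `λ_κ = ∑_{α ∈ R₊} κ_α + (d - 2) / 2`. -/
noncomputable def dunklIndex {d : ℕ} (Rpos : Finset (EuclideanSpace ℝ (Fin d)))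
    (κ : EuclideanSpace ℝ (Fin d) → ℝ) : ℝ :=
  ∑ α ∈ Rpos, κ α + ((d : ℝ) - 2) / 2

/-- The weight `h_κ(x) = ∏_{α ∈ R₊} |⟨α, x⟩| ^ κ_α`. -/
noncomputable def dunklWeight {d : ℕ} (Rpos : Finset (EuclideanSpace ℝ (Fin d)))
    (κ : EuclideanSpace ℝ (Fin d) → ℝ) (x : EuclideanSpace ℝ (Fin d)) : ℝ :=
  ∏ α ∈ Rpos, |inner ℝ α x| ^ κ α

/-- `b_κ = (∫_{ℝ^d} h_κ(x)² e^{-‖x‖²/2} dx)⁻¹`. -/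
noncomputable def dunklConst {d : ℕ} (Rpos : Finset (EuclideanSpace ℝ (Fin d)))
    (κ : EuclideanSpace ℝ (Fin d) → ℝ) : ℝ :=
  (∫ x : EuclideanSpace ℝ (Fin d), dunklWeight Rpos κ x ^ 2 * Real.exp (-‖x‖ ^ 2 / 2))⁻¹

/-- Surface measure `dω` on the unit sphere `S^{d-1}`, induced from Lebesgue measure by polar
coordinates (for `d = 1` the counting measure on two points). -/
noncomputable def surfaceMeasure (d : ℕ) :
    Measure (Metric.sphere (0 : EuclideanSpace ℝ (Fin d)) 1) :=
  (volume : Measure (EuclideanSpace ℝ (Fin d))).toSphere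

/-- The total weighted mass `∫_{S^{d-1}} h_κ² dω`. -/
noncomputable def sphereMass {d : ℕ} (Rpos : Finset (EuclideanSpace ℝ (Fin d)))
    (κ : EuclideanSpace ℝ (Fin d) → ℝ) : ℝ :=
  ∫ x : Metric.sphere (0 : EuclideanSpace ℝ (Fin d)) 1,
    dunklWeight Rpos κ (x : EuclideanSpace ℝ (Fin d)) ^ 2 ∂(surfaceMeasure d)

section Polynomials

variable {𝕜 : Type*} [RCLike 𝕜] {d : ℕ}

/-- Value at a point of `ℝ^d` of a polynomial with coefficients in `𝕜` (`ℝ` or `ℂ`). -/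
noncomputable def evalAt (x : EuclideanSpace ℝ (Fin d)) (p : MvPolynomial (Fin d) 𝕜) : 𝕜 :=
  eval (fun i => ((x i : ℝ) : 𝕜)) p

/-- The linear polynomial `x ↦ ⟨α, x⟩`. -/
noncomputable def linForm (𝕜 : Type*) [RCLike 𝕜] (α : EuclideanSpace ℝ (Fin d)) :
    MvPolynomial (Fin d) 𝕜 :=
  ∑ i, C ((α i : ℝ) : 𝕜) * X i

/-- The polynomial `p ∘ r_α`, through `r_α x = x - (2 ⟨α, x⟩ / ⟨α, α⟩) α`. -/
noncomputable def reflectPoly (α : EuclideanSpace ℝ (Fin d)) (p : MvPolynomial (Fin d) 𝕜) :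
    MvPolynomial (Fin d) 𝕜 :=
  aeval (fun i => X i - C ((2 * α i / ‖α‖ ^ 2 : ℝ) : 𝕜) * linForm 𝕜 α) p

theorem evalAt_linForm (α x : EuclideanSpace ℝ (Fin d)) :
    evalAt x (linForm 𝕜 α) = ((inner ℝ α x : ℝ) : 𝕜) := by
  simp [evalAt, linForm, PiLp.inner_apply, mul_comm]

theorem evalAt_reflectPoly (α x : EuclideanSpace ℝ (Fin d)) (p : MvPolynomial (Fin d) 𝕜) :
    evalAt x (reflectPoly α p) = evalAt ((Submodule.span ℝ {α})ᗮ.reflection x) p := by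
  have hlin := evalAt_linForm (𝕜 := 𝕜) α x
  unfold evalAt at hlin
  induction p using MvPolynomial.induction_on with
  | C a => simp [evalAt, reflectPoly]
  | add p q hp hq =>
    simp only [evalAt, reflectPoly, map_add] at hp hq ⊢
    rw [hp, hq]
  | mul_X p i hp =>
    simp only [evalAt, reflectPoly, map_mul, aeval_X, eval_X, map_sub, eval_C] at hp ⊢
    rw [hp, hlin, Submodule.reflection_orthogonal_apply, Submodule.reflection_singleton_apply]
    congr 1
    simp
    ring

theorem linForm_dvd_sub_reflectPoly (α : EuclideanSpace ℝ (Fin d))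
    (p : MvPolynomial (Fin d) 𝕜) : linForm 𝕜 α ∣ p - reflectPoly α p := by
  induction p using MvPolynomial.induction_on with
  | C a => simp [reflectPoly]
  | add p q hp hq =>
    have h : p + q - reflectPoly α (p + q) = (p - reflectPoly α p) + (q - reflectPoly α q) := by
      simp only [reflectPoly, map_add]
      ring
    rw [h]
    exact dvd_add hp hq
  | mul_X p i hp =>
    have h : p * X i - reflectPoly α (p * X i) = (p - reflectPoly α p) * X i +
        linForm 𝕜 α * (reflectPoly α p * C ((2 * α i / ‖α‖ ^ 2 : ℝ) : 𝕜)) := by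
      simp only [reflectPoly, map_mul, aeval_X]
      ring
    rw [h]
    exact dvd_add (hp.mul_right _) (dvd_mul_right _ _)

/-- The polynomial `(p(x) - p(r_α x)) / ⟨α, x⟩`; for `α ≠ 0` it is the unique polynomial `q`
with `⟨α, x⟩ q(x) = p(x) - p(r_α x)`. -/
noncomputable def diffQuotient (α : EuclideanSpace ℝ (Fin d)) (p : MvPolynomial (Fin d) 𝕜) :
    MvPolynomial (Fin d) 𝕜 :=
  (linForm_dvd_sub_reflectPoly α p).choose

theorem linForm_mul_diffQuotient (α : EuclideanSpace ℝ (Fin d)) (p : MvPolynomial (Fin d) 𝕜) :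
    linForm 𝕜 α * diffQuotient α p = p - reflectPoly α p :=
  (linForm_dvd_sub_reflectPoly α p).choose_spec.symm

/-- Off the hyperplane `α^⊥` the difference quotient takes its literal value. -/
theorem evalAt_diffQuotient (α x : EuclideanSpace ℝ (Fin d)) (p : MvPolynomial (Fin d) 𝕜)
    (hx : inner ℝ α x ≠ (0 : ℝ)) :
    evalAt x (diffQuotient α p) =
      (evalAt x p - evalAt ((Submodule.span ℝ {α})ᗮ.reflection x) p) /
        ((inner ℝ α x : ℝ) : 𝕜) := by
  have hx' : ((inner ℝ α x : ℝ) : 𝕜) ≠ 0 := by exact_mod_cast hx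
  have h := congrArg (evalAt x) (linForm_mul_diffQuotient α p)
  rw [eq_div_iff hx', ← evalAt_reflectPoly, ← evalAt_linForm, mul_comm]
  simpa only [evalAt, map_mul, map_sub] using h

/-- The Dunkl operator on polynomials:
`D_ξ p = ∂_ξ p + ∑_{α ∈ R₊} κ_α ⟨α, ξ⟩ (p(x) - p(r_α x)) / ⟨α, x⟩`. -/
noncomputable def dunklOp (Rpos : Finset (EuclideanSpace ℝ (Fin d)))
    (κ : EuclideanSpace ℝ (Fin d) → ℝ) (ξ : EuclideanSpace ℝ (Fin d))
    (p : MvPolynomial (Fin d) 𝕜) : MvPolynomial (Fin d) 𝕜 :=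
  ∑ i, C ((ξ i : ℝ) : 𝕜) * pderiv i p +
    ∑ α ∈ Rpos, C ((κ α * inner ℝ α ξ : ℝ) : 𝕜) * diffQuotient α p

/-- The Dunkl Laplacian `Δ_κ = ∑_j D_j²`, with `D_j = D_{e_j}`. -/
noncomputable def dunklLaplacian (Rpos : Finset (EuclideanSpace ℝ (Fin d)))
    (κ : EuclideanSpace ℝ (Fin d) → ℝ) (p : MvPolynomial (Fin d) 𝕜) :
    MvPolynomial (Fin d) 𝕜 :=
  ∑ j, dunklOp Rpos κ (EuclideanSpace.single j 1) (dunklOp Rpos κ (EuclideanSpace.single j 1) p)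

/-- The integral `∫_{S^{d-1}} p h_κ² dω`. -/
noncomputable def sphereIntegral (Rpos : Finset (EuclideanSpace ℝ (Fin d)))
    (κ : EuclideanSpace ℝ (Fin d) → ℝ) (p : MvPolynomial (Fin d) 𝕜) : 𝕜 :=
  ∫ x : Metric.sphere (0 : EuclideanSpace ℝ (Fin d)) 1,
    evalAt (x : EuclideanSpace ℝ (Fin d)) p *
      ((dunklWeight Rpos κ (x : EuclideanSpace ℝ (Fin d)) ^ 2 : ℝ) : 𝕜) ∂(surfaceMeasure d)

end Polynomials

end DunklPizzetti

namespace DunklPizzetti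

open MeasureTheory MvPolynomial Filter Topology

variable {𝕜 : Type*} [RCLike 𝕜] {d : ℕ}

local notation "E" => EuclideanSpace ℝ (Fin d)

/-! Everything is read off from Gaussian integrals. Write `I(p)` for the integral of `p` against
`h_κ² e^{-‖x‖²/2}` (`gaussIntegral`). The heart is `I(D_ξ p) = I(⟨ξ, x⟩ p)`
(`gaussIntegral_dunklOp`): integrating by parts, the derivative of `h_κ²` produces `2 κ_α ⟨α, ξ⟩ p /
⟨α, x⟩`, and averaging over `r_α`, which preserves the measure, turns this into the difference
quotient of the Dunkl operator. Since `h_κ²` may fail to be differentiable on the root hyperplanes,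
the computation is done with `∏ (⟨α, x⟩² + ε) ^ κ_α`, and then `ε → 0`.

For `p` homogeneous of degree `n`, it follows that `I(Δ_κ p) = ∑ I(x_j D_j p)`. Euler's identity,
with reflection terms that integrate to zero, gives `n I(p)` (`gaussIntegral_dunklLaplacian`).
Iteration down to a constant gives `2^m m! I(p) = (Δ_κ^m p)(0) I(1)` for `n = 2m`, and `I(p) = 0`
for odd `n`.

In polar coordinates `I(p)` is the spherical integral times a Gamma factor
(`gaussIntegral_eq_sphereIntegral`). For homogeneous `p` the series thus has at most one nonzero
term; the general case is a sum over homogeneous components. The mean value property compares a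
harmonic `p` with the constant `1`. -/

/-- Functions bounded by a polynomial in the norm. -/
def PolyBounded {V F : Type*} [Norm V] [Norm F] (f : V → F) : Prop :=
  ∃ (C : ℝ) (N : ℕ), ∀ x, ‖f x‖ ≤ C * (1 + ‖x‖) ^ N

/-! ### Polynomial growth and integrability against the Gaussian -/

section PolyBounded

variable {V : Type*} [SeminormedAddCommGroup V] {F : Type*} [NormedDivisionRing F]

theorem PolyBounded.nonneg {F : Type*} [SeminormedAddCommGroup F] {f : V → F}
    (hf : PolyBounded f) :
    ∃ (C : ℝ) (N : ℕ), 0 ≤ C ∧ ∀ x, ‖f x‖ ≤ C * (1 + ‖x‖) ^ N := by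
  obtain ⟨C, N, h⟩ := hf
  refine ⟨C, N, ?_, h⟩
  have := (norm_nonneg _).trans (h 0)
  simpa using this

theorem PolyBounded.const (c : F) : PolyBounded (fun _ : V => c) :=
  ⟨‖c‖, 0, fun x => by simp⟩

theorem PolyBounded.add {f g : V → F} (hf : PolyBounded f) (hg : PolyBounded g) :
    PolyBounded (fun x => f x + g x) := by
  obtain ⟨C, N, hC, hf⟩ := hf.nonneg
  obtain ⟨D, M, hD, hg⟩ := hg.nonneg
  refine ⟨C + D, N + M, fun x => ?_⟩
  have h1 : 1 ≤ 1 + ‖x‖ := by linarith [norm_nonneg x]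
  have hN : (1 + ‖x‖) ^ N ≤ (1 + ‖x‖) ^ (N + M) := pow_le_pow_right₀ h1 (by omega)
  have hM : (1 + ‖x‖) ^ M ≤ (1 + ‖x‖) ^ (N + M) := pow_le_pow_right₀ h1 (by omega)
  calc ‖f x + g x‖ ≤ ‖f x‖ + ‖g x‖ := norm_add_le _ _
    _ ≤ C * (1 + ‖x‖) ^ N + D * (1 + ‖x‖) ^ M := add_le_add (hf x) (hg x)
    _ ≤ C * (1 + ‖x‖) ^ (N + M) + D * (1 + ‖x‖) ^ (N + M) := by gcongr
    _ = _ := by ring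

theorem PolyBounded.mul {f g : V → F} (hf : PolyBounded f) (hg : PolyBounded g) :
    PolyBounded (fun x => f x * g x) := by
  obtain ⟨C, N, hC, hf⟩ := hf.nonneg
  obtain ⟨D, M, hD, hg⟩ := hg.nonneg
  refine ⟨C * D, N + M, fun x => ?_⟩
  calc ‖f x * g x‖ = ‖f x‖ * ‖g x‖ := norm_mul _ _
    _ ≤ (C * (1 + ‖x‖) ^ N) * (D * (1 + ‖x‖) ^ M) := by
        gcongr
        · exact hf x
        · exact hg x
    _ = _ := by ring

theorem PolyBounded.smul {f : V → ℝ} {g : V → 𝕜} (hf : PolyBounded f) (hg : PolyBounded g) :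
    PolyBounded (fun x => f x • g x) := by
  have hf' : PolyBounded (fun x => (f x : 𝕜)) := by
    obtain ⟨C, N, h⟩ := hf
    exact ⟨C, N, fun x => by rw [RCLike.norm_ofReal]; exact h x⟩
  simpa only [RCLike.real_smul_eq_coe_mul] using hf'.mul hg

theorem PolyBounded.pow {f : V → F} (hf : PolyBounded f) (n : ℕ) :
    PolyBounded (fun x => f x ^ n) := by
  induction n with
  | zero => simpa using PolyBounded.const (1 : F)
  | succ n ih => simpa only [pow_succ] using ih.mul hf

theorem PolyBounded.prod {ι : Type*} {F : Type*} [NormedField F] {f : ι → V → F} (s : Finset ι)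
    (hf : ∀ i ∈ s, PolyBounded (f i)) : PolyBounded (fun x => ∏ i ∈ s, f i x) := by
  classical
  induction s using Finset.induction_on with
  | empty => simpa using PolyBounded.const (1 : F)
  | insert a s ha ih =>
    simp only [Finset.prod_insert ha]
    exact (hf a (by simp)).mul (ih fun i hi => hf i (by simp [hi]))

theorem PolyBounded.mono {F G : Type*} [Norm F] [Norm G] {f : V → F} {g : V → G}
    (hg : PolyBounded g) (h : ∀ x, ‖f x‖ ≤ ‖g x‖) : PolyBounded f := by
  obtain ⟨C, N, hg⟩ := hg
  exact ⟨C, N, fun x => (h x).trans (hg x)⟩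

end PolyBounded

/-- Combines `t^k / k! ≤ e^t` at `t = 1 + r` with `1 + r - r²/2 ≤ 3/2`, which is `(r - 1)² ≥ 0`. -/
theorem one_add_pow_mul_exp_le (k : ℕ) {r : ℝ} (hr : 0 ≤ r) :
    (1 + r) ^ k * Real.exp (-r ^ 2 / 2) ≤ k.factorial * Real.exp (3 / 2) := by
  have h1 : (1 + r) ^ k ≤ k.factorial * Real.exp (1 + r) := by
    have := Real.pow_div_factorial_le_exp (1 + r) (by linarith) k
    rw [div_le_iff₀ (by positivity)] at this
    linarith
  calc (1 + r) ^ k * Real.exp (-r ^ 2 / 2)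
      ≤ k.factorial * Real.exp (1 + r) * Real.exp (-r ^ 2 / 2) := by gcongr
    _ = k.factorial * Real.exp (1 + r + -r ^ 2 / 2) := by rw [mul_assoc, ← Real.exp_add]
    _ ≤ _ := by
      gcongr
      nlinarith [sq_nonneg (r - 1)]

/-- The Gaussian absorbs any power of `1 + ‖x‖`, so the integrand is dominated by a multiple of `(1
+ ‖x‖)^{-(d+1)}`, integrable on `ℝ^d`. -/
theorem PolyBounded.integrable_exp_smul {F : Type*} [NormedAddCommGroup F] [NormedSpace ℝ F]
    {f : E → F} (hf : PolyBounded f) (hm : AEStronglyMeasurable f) :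
    Integrable (fun x : E => Real.exp (-‖x‖ ^ 2 / 2) • f x) := by
  obtain ⟨C, N, hC, hf⟩ := hf.nonneg
  have hi := (integrable_one_add_norm (μ := (volume : Measure E)) (r := (d + 1 : ℕ))
    (by simp)).const_mul (C * ((N + (d + 1)).factorial * Real.exp (3 / 2)))
  refine hi.mono' (AEStronglyMeasurable.smul (Continuous.aestronglyMeasurable (by fun_prop)) hm)
    (Eventually.of_forall fun x => ?_)
  have hpos : 0 < 1 + ‖x‖ := by positivity
  rw [norm_smul, Real.norm_of_nonneg (Real.exp_pos _).le, Real.rpow_neg hpos.le,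
    Real.rpow_natCast, ← div_eq_mul_inv, le_div_iff₀ (by positivity)]
  calc Real.exp (-‖x‖ ^ 2 / 2) * ‖f x‖ * (1 + ‖x‖) ^ (d + 1)
      ≤ Real.exp (-‖x‖ ^ 2 / 2) * (C * (1 + ‖x‖) ^ N) * (1 + ‖x‖) ^ (d + 1) := by
        gcongr
        exact hf x
    _ = C * ((1 + ‖x‖) ^ (N + (d + 1)) * Real.exp (-‖x‖ ^ 2 / 2)) := by ring
    _ ≤ _ := mul_le_mul_of_nonneg_left (one_add_pow_mul_exp_le _ (norm_nonneg x)) hC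

/-! ### Polynomials as functions: continuity, growth, directional derivatives -/

theorem continuous_evalAt (p : MvPolynomial (Fin d) 𝕜) : Continuous (fun x : E => evalAt x p) := by
  unfold evalAt
  exact (MvPolynomial.continuous_eval p).comp
    (continuous_pi fun i => RCLike.continuous_ofReal.comp (by fun_prop))

@[simp] theorem evalAt_add (x : E) (p q : MvPolynomial (Fin d) 𝕜) :
    evalAt x (p + q) = evalAt x p + evalAt x q := by simp [evalAt]

@[simp] theorem evalAt_sub (x : E) (p q : MvPolynomial (Fin d) 𝕜) :
    evalAt x (p - q) = evalAt x p - evalAt x q := by simp [evalAt]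

@[simp] theorem evalAt_mul (x : E) (p q : MvPolynomial (Fin d) 𝕜) :
    evalAt x (p * q) = evalAt x p * evalAt x q := by simp [evalAt]

@[simp] theorem evalAt_C (x : E) (a : 𝕜) : evalAt x (C a) = a := by simp [evalAt]

@[simp] theorem evalAt_sum {ι : Type*} (s : Finset ι) (x : E)
    (p : ι → MvPolynomial (Fin d) 𝕜) :
    evalAt x (∑ i ∈ s, p i) = ∑ i ∈ s, evalAt x (p i) := by simp [evalAt]

theorem polyBounded_evalAt (p : MvPolynomial (Fin d) 𝕜) :
    PolyBounded (fun x : E => evalAt x p) := by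
  induction p using MvPolynomial.induction_on with
  | C a => simpa using PolyBounded.const a
  | add p q hp hq => simpa using hp.add hq
  | mul_X p i hp =>
    simp only [evalAt_mul]
    refine hp.mul ⟨1, 1, fun x => ?_⟩
    have := PiLp.norm_apply_le x i
    simp only [evalAt, eval_X, RCLike.norm_ofReal, one_mul, pow_one]
    rw [Real.norm_eq_abs] at this
    linarith

theorem hasLineDerivAt_evalAt (p : MvPolynomial (Fin d) 𝕜) (x ξ : E) :
    HasLineDerivAt ℝ (fun x : E => evalAt x p)
      (evalAt x (∑ i, C ((ξ i : ℝ) : 𝕜) * pderiv i p)) x ξ := by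
  unfold HasLineDerivAt
  induction p using MvPolynomial.induction_on with
  | C a => simpa [evalAt] using hasDerivAt_const (0 : ℝ) a
  | add p q hp hq => simpa [mul_add, Finset.sum_add_distrib, Pi.add_def] using hp.add hq
  | mul_X p i hp =>
    have hX : HasDerivAt (fun t : ℝ => evalAt (x + t • ξ) (X i : MvPolynomial (Fin d) 𝕜))
        (ξ i : 𝕜) 0 := by
      have h0 : HasDerivAt (fun t : ℝ => x i + t * ξ i) (ξ i) 0 := by
        simpa using ((hasDerivAt_id (0 : ℝ)).mul_const (ξ i)).const_add (x i)
      have := (RCLike.ofRealCLM (K := 𝕜)).hasFDerivAt.comp_hasDerivAt (0 : ℝ) h0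
      simpa [evalAt, Function.comp_def] using this
    have := hp.mul hX
    simp only [evalAt_mul]
    refine this.congr_deriv ?_
    simp only [zero_smul, add_zero, Derivation.leibniz, pderiv_X, smul_eq_mul, evalAt_sum,
      evalAt_mul, evalAt_C, evalAt_add, mul_add, Finset.sum_add_distrib, Finset.sum_mul]
    rw [add_comm]
    congr 1
    · rw [Finset.sum_eq_single i]
      · simp [evalAt]; ring
      · intro j _ hj
        simp [hj.symm, evalAt]
      · simp
    · exact Finset.sum_congr rfl fun j _ => by ring

/-! ### The regularised weight and its derivatives -/

/-- The regularised squared weight `∏ (⟨α, x⟩² + ε) ^ κ_α`. -/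
noncomputable def regWeight (S : Finset E) (κ : E → ℝ) (ε : ℝ) (x : E) : ℝ :=
  ∏ α ∈ S, (inner ℝ α x ^ 2 + ε) ^ κ α

theorem regWeight_zero (S : Finset E) (κ : E → ℝ) (x : E) :
    regWeight S κ 0 x = dunklWeight S κ x ^ 2 := by
  unfold regWeight dunklWeight
  rw [← Finset.prod_pow]
  refine Finset.prod_congr rfl fun α _ => ?_
  rw [add_zero, ← sq_abs, ← Real.rpow_natCast, ← Real.rpow_natCast, ← Real.rpow_mul (abs_nonneg _),
    ← Real.rpow_mul (abs_nonneg _), mul_comm]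

theorem regWeight_nonneg (S : Finset E) (κ : E → ℝ) {ε : ℝ} (hε : 0 ≤ ε) (x : E) :
    0 ≤ regWeight S κ ε x :=
  Finset.prod_nonneg fun α _ => by positivity

/-- Makes the weight at `ε = 1` a majorant for dominated convergence as `ε → 0`. -/
theorem regWeight_mono {S : Finset E} {κ : E → ℝ} (hκ : ∀ α ∈ S, 0 ≤ κ α) {ε δ : ℝ}
    (hε : 0 ≤ ε) (h : ε ≤ δ) (x : E) : regWeight S κ ε x ≤ regWeight S κ δ x :=
  Finset.prod_le_prod (fun α _ => by positivity) fun α hα =>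
    Real.rpow_le_rpow (by positivity) (by linarith) (hκ α hα)

theorem continuous_regWeight {S : Finset E} {κ : E → ℝ} (hκ : ∀ α ∈ S, 0 ≤ κ α) (ε : ℝ) :
    Continuous (regWeight S κ ε) :=
  continuous_finsetProd _ fun α hα =>
    Continuous.rpow_const (by fun_prop) fun _ => Or.inr (hκ α hα)

theorem tendsto_regWeight {S : Finset E} {κ : E → ℝ} (hκ : ∀ α ∈ S, 0 ≤ κ α) (x : E) :
    Tendsto (fun ε => regWeight S κ ε x) (𝓝[>] 0) (𝓝 (regWeight S κ 0 x)) := by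
  have : Continuous (fun ε => regWeight S κ ε x) :=
    continuous_finsetProd _ fun α hα =>
      Continuous.rpow_const (by fun_prop) fun _ => Or.inr (hκ α hα)
  exact this.continuousAt.mono_left nhdsWithin_le_nhds

theorem polyBounded_inner (α : E) : PolyBounded (fun x : E => (inner ℝ α x : ℝ)) := by
  refine ⟨‖α‖, 1, fun x => (norm_inner_le_norm α x).trans ?_⟩
  rw [pow_one]
  gcongr
  linarith

theorem polyBounded_regWeight {S : Finset E} {κ : E → ℝ} (hκ : ∀ α ∈ S, 0 ≤ κ α) {ε : ℝ}
    (hε : 0 ≤ ε) : PolyBounded (regWeight S κ ε) := by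
  -- The extra `1` makes each base at least `1`, so the real exponent `κ α` can be raised to its
  -- ceiling.
  have h1 : PolyBounded (fun x : E => ∏ α ∈ S, ((inner ℝ α x : ℝ) ^ 2 + (ε + 1)) ^ ⌈κ α⌉₊) :=
    PolyBounded.prod S fun α _ =>
      (((polyBounded_inner α).pow 2).add (PolyBounded.const (ε + 1))).pow _
  refine h1.mono fun x => ?_
  rw [Real.norm_of_nonneg (regWeight_nonneg S κ hε x), Real.norm_of_nonneg
    (Finset.prod_nonneg fun α _ => by positivity)]
  refine Finset.prod_le_prod (fun α _ => by positivity) fun α hα => ?_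
  rw [← Real.rpow_natCast (_ + _)]
  calc ((inner ℝ α x : ℝ) ^ 2 + ε) ^ κ α ≤ ((inner ℝ α x : ℝ) ^ 2 + (ε + 1)) ^ κ α :=
        Real.rpow_le_rpow (by positivity) (by linarith) (hκ α hα)
    _ ≤ _ := Real.rpow_le_rpow_of_exponent_le (by nlinarith [sq_nonneg (inner ℝ α x : ℝ)])
        (Nat.le_ceil _)

/-- The regularised weight times the Gaussian. -/
noncomputable def gaussWeight (S : Finset E) (κ : E → ℝ) (ε : ℝ) (x : E) : ℝ :=
  regWeight S κ ε x * Real.exp (-‖x‖ ^ 2 / 2)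

theorem gaussWeight_nonneg (S : Finset E) (κ : E → ℝ) {ε : ℝ} (hε : 0 ≤ ε) (x : E) :
    0 ≤ gaussWeight S κ ε x :=
  mul_nonneg (regWeight_nonneg S κ hε x) (Real.exp_pos _).le

theorem continuous_gaussWeight {S : Finset E} {κ : E → ℝ} (hκ : ∀ α ∈ S, 0 ≤ κ α) (ε : ℝ) :
    Continuous (gaussWeight S κ ε) :=
  (continuous_regWeight hκ ε).mul (by fun_prop)

theorem integrable_gaussWeight_smul {S : Finset E} {κ : E → ℝ} (hκ : ∀ α ∈ S, 0 ≤ κ α) {ε : ℝ} (hε : 0 ≤ ε) {f : E → 𝕜}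
    (hf : PolyBounded f) (hc : Continuous f) :
    Integrable (fun x => gaussWeight S κ ε x • f x) := by
  have := ((polyBounded_regWeight hκ hε).smul hf).integrable_exp_smul
    ((continuous_regWeight hκ ε).smul hc).aestronglyMeasurable
  refine this.congr (Eventually.of_forall fun x => ?_)
  simp only [gaussWeight, smul_smul, mul_comm]

/-- For `ε > 0` every base is positive, so the real powers are differentiable everywhere and the
logarithmic derivative has no singularity on the root hyperplanes. -/
theorem hasLineDerivAt_regWeight (S : Finset E) (κ : E → ℝ) {ε : ℝ} (hε : 0 < ε) (x ξ : E) :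
    HasLineDerivAt ℝ (regWeight S κ ε)
      ((∑ α ∈ S, 2 * (κ α * inner ℝ α ξ) * (inner ℝ α x / (inner ℝ α x ^ 2 + ε))) *
        regWeight S κ ε x) x ξ := by
  classical
  unfold HasLineDerivAt regWeight
  induction S using Finset.induction_on with
  | empty => simpa using hasDerivAt_const (0 : ℝ) (1 : ℝ)
  | insert α S hα ih =>
    simp only [Finset.prod_insert hα, Finset.sum_insert hα]
    have h1 : HasDerivAt (fun t : ℝ => inner ℝ α (x + t • ξ)) (inner ℝ α ξ) 0 := by
      simp only [inner_add_right, inner_smul_right]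
      simpa using ((hasDerivAt_id (0 : ℝ)).mul_const (inner ℝ α ξ)).const_add (inner ℝ α x)
    have hpos : 0 < (inner ℝ α x : ℝ) ^ 2 + ε := by positivity
    have h2 := ((h1.pow 2).add_const ε).rpow_const (p := κ α) (Or.inl (by simpa using hpos.ne'))
    refine (h2.mul ih).congr_deriv ?_
    simp only [Pi.pow_apply, zero_smul, add_zero, Real.rpow_sub_one hpos.ne']
    field_simp
    ring

theorem hasLineDerivAt_exp_norm_sq (x ξ : E) :
    HasLineDerivAt ℝ (fun x : E => Real.exp (-‖x‖ ^ 2 / 2))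
      (-inner ℝ ξ x * Real.exp (-‖x‖ ^ 2 / 2)) x ξ := by
  unfold HasLineDerivAt
  have h0 : HasDerivAt (fun t : ℝ => x + t • ξ) ξ 0 := by
    simpa using ((hasDerivAt_id (0 : ℝ)).smul_const ξ).const_add x
  have h := ((h0.norm_sq.neg).div_const 2).exp
  refine h.congr_deriv ?_
  simp [real_inner_comm]
  ring

theorem hasLineDerivAt_gaussWeight (S : Finset E) (κ : E → ℝ) {ε : ℝ} (hε : 0 < ε) (x ξ : E) :
    HasLineDerivAt ℝ (gaussWeight S κ ε)
      ((∑ α ∈ S, 2 * (κ α * inner ℝ α ξ) * (inner ℝ α x / (inner ℝ α x ^ 2 + ε)) -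
        inner ℝ ξ x) * gaussWeight S κ ε x) x ξ := by
  have h1 := hasLineDerivAt_regWeight S κ hε x ξ
  have h2 := hasLineDerivAt_exp_norm_sq x ξ
  unfold HasLineDerivAt at h1 h2 ⊢
  refine (h1.mul h2).congr_deriv ?_
  simp only [zero_smul, add_zero, gaussWeight]
  ring

/-! ### Invariance of the weight under the reflections -/

theorem reflection_orthogonal_self (α : E) : (Submodule.span ℝ {α})ᗮ.reflection α = -α :=
  Submodule.reflection_mem_subspace_orthogonal_precomplement_eq_neg
    (Submodule.mem_span_singleton_self α)

theorem inner_reflection_left (α x y : E) :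
    inner ℝ x ((Submodule.span ℝ {α})ᗮ.reflection y) =
      inner ℝ ((Submodule.span ℝ {α})ᗮ.reflection x) y := by
  conv_rhs => rw [← Submodule.reflection_reflection (Submodule.span ℝ {α})ᗮ y,
    LinearIsometryEquiv.inner_map_map]

section RootSystem

variable {R Rpos : Finset (EuclideanSpace ℝ (Fin d))} {κ : EuclideanSpace ℝ (Fin d) → ℝ}

theorem IsPositiveSystem.subset (h : IsPositiveSystem R Rpos) : Rpos ⊆ R := by
  obtain ⟨v, -, hv⟩ := h
  exact fun α hα => ((hv α).1 hα).1

theorem IsReducedRootSystem.neg_mem (hR : IsReducedRootSystem R) {α : E} (hα : α ∈ R) :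
    -α ∈ R := by
  simpa only [reflection_orthogonal_self] using hR.reflection_mem α hα α hα

theorem IsMultiplicityFunction.reflection (hκ : IsMultiplicityFunction R κ) {α β : E}
    (hα : α ∈ R) (hβ : β ∈ R) : κ ((Submodule.span ℝ {α})ᗮ.reflection β) = κ β :=
  hκ.invariant _ (Subgroup.subset_closure ⟨α, hα, rfl⟩) β hβ

theorem IsMultiplicityFunction.neg (hκ : IsMultiplicityFunction R κ) {α : E} (hα : α ∈ R) :
    κ (-α) = κ α := by
  simpa only [reflection_orthogonal_self] using hκ.reflection hα hα

/-- The product of an even function over a root system is the square of the product over a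
positive system. -/
theorem prod_eq_sq_prod_pos (hR : IsReducedRootSystem R) (hRpos : IsPositiveSystem R Rpos)
    (f : E → ℝ) (hf : ∀ α ∈ R, f (-α) = f α) :
    ∏ α ∈ R, f α = (∏ α ∈ Rpos, f α) ^ 2 := by
  classical
  obtain ⟨v, hv0, hv⟩ := hRpos
  have h1 : Rpos = R.filter fun α => 0 < (inner ℝ α v : ℝ) := by
    ext α; simp [hv]
  rw [← Finset.prod_filter_mul_prod_filter_not R (fun α => 0 < (inner ℝ α v : ℝ)), h1, sq]
  congr 1
  -- Negation exchanges the two halves of `R`; no root is orthogonal to `v`, so the second half is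
  -- strictly negative.
  refine Finset.prod_nbij' (fun α => -α) (fun α => -α) ?_ ?_ (by simp) (by simp) ?_
  · intro α hα
    simp only [Finset.mem_filter, not_lt] at hα ⊢
    exact ⟨hR.neg_mem hα.1, by
      rw [inner_neg_left]; linarith [lt_of_le_of_ne hα.2 (hv0 α hα.1)]⟩
  · intro α hα
    simp only [Finset.mem_filter, not_lt] at hα ⊢
    exact ⟨hR.neg_mem hα.1, by rw [inner_neg_left]; linarith [hα.2]⟩
  · intro α hα
    exact (hf α (Finset.mem_filter.1 hα).1).symm

/-- A reflection permutes `R` but not `Rpos`. The square of the weight is a product over all of `R`,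
where invariance is a reindexing; nonnegativity allows the square to be removed. -/
theorem regWeight_reflection (hR : IsReducedRootSystem R) (hRpos : IsPositiveSystem R Rpos)
    (hκ : IsMultiplicityFunction R κ) {ε : ℝ} (hε : 0 ≤ ε) {α : E} (hα : α ∈ R) (x : E) :
    regWeight Rpos κ ε ((Submodule.span ℝ {α})ᗮ.reflection x) = regWeight Rpos κ ε x := by
  rw [← pow_left_inj₀ (regWeight_nonneg _ _ hε _) (regWeight_nonneg _ _ hε _) two_ne_zero]
  unfold regWeight
  rw [← prod_eq_sq_prod_pos hR hRpos, ← prod_eq_sq_prod_pos hR hRpos]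
  · refine Finset.prod_nbij' (fun β => (Submodule.span ℝ {α})ᗮ.reflection β)
      (fun β => (Submodule.span ℝ {α})ᗮ.reflection β) (fun β hβ => hR.reflection_mem α hα β hβ)
      (fun β hβ => hR.reflection_mem α hα β hβ) (by simp) (by simp) fun β hβ => ?_
    rw [inner_reflection_left, hκ.reflection hα hβ]
  · intro β hβ
    rw [hκ.neg hβ, inner_neg_left, neg_sq]
  · intro β hβ
    rw [hκ.neg hβ, inner_neg_left, neg_sq]

theorem gaussWeight_reflection (hR : IsReducedRootSystem R) (hRpos : IsPositiveSystem R Rpos)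
    (hκ : IsMultiplicityFunction R κ) {ε : ℝ} (hε : 0 ≤ ε) {α : E} (hα : α ∈ R) (x : E) :
    gaussWeight Rpos κ ε ((Submodule.span ℝ {α})ᗮ.reflection x) = gaussWeight Rpos κ ε x := by
  rw [gaussWeight, regWeight_reflection hR hRpos hκ hε hα, LinearIsometryEquiv.norm_map,
    gaussWeight]

/-! ### Integration by parts at `ε > 0` -/

theorem polyBounded_div_sq_add {ε : ℝ} (hε : 0 < ε) (α : E) :
    PolyBounded (fun x : E => (inner ℝ α x : ℝ) / (inner ℝ α x ^ 2 + ε)) := by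
  refine ((polyBounded_inner α).mul (PolyBounded.const (1 / ε))).mono fun x => ?_
  rw [norm_div, norm_mul, norm_div, norm_one, div_eq_mul_one_div]
  rw [Real.norm_of_nonneg hε.le, Real.norm_of_nonneg (by positivity : 0 ≤ (inner ℝ α x : ℝ) ^ 2 + ε)]
  gcongr
  nlinarith [sq_nonneg (inner ℝ α x : ℝ)]

theorem continuous_div_sq_add {ε : ℝ} (hε : 0 < ε) (α : E) :
    Continuous (fun x : E => (inner ℝ α x : ℝ) / (inner ℝ α x ^ 2 + ε)) :=
  Continuous.div (by fun_prop) (by fun_prop) fun x => by positivity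

theorem evalAt_sub_reflection (α x : E) (p : MvPolynomial (Fin d) 𝕜) :
    evalAt x p - evalAt ((Submodule.span ℝ {α})ᗮ.reflection x) p =
      (inner ℝ α x : ℝ) • evalAt x (diffQuotient α p) := by
  rw [← evalAt_reflectPoly, ← evalAt_sub, ← linForm_mul_diffQuotient, evalAt_mul, evalAt_linForm,
    RCLike.real_smul_eq_coe_mul]

/-- The scalar factor is odd under `r_α` and the measure is invariant. Averaging the integral with
its reflected copy therefore replaces `p` by `p - p ∘ r_α`, which is `⟨α, x⟩` times the difference
quotient. -/
theorem two_mul_integral_div_sq_add (hR : IsReducedRootSystem R)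
    (hRpos : IsPositiveSystem R Rpos) (hκ : IsMultiplicityFunction R κ) {ε : ℝ} (hε : 0 < ε)
    {α : E} (hα : α ∈ R) (p : MvPolynomial (Fin d) 𝕜) :
    2 * ∫ x : E, (inner ℝ α x / (inner ℝ α x ^ 2 + ε) * gaussWeight Rpos κ ε x) • evalAt x p =
      ∫ x : E, (inner ℝ α x ^ 2 / (inner ℝ α x ^ 2 + ε) * gaussWeight Rpos κ ε x) •
        evalAt x (diffQuotient α p) := by
  have hnn : ∀ β ∈ Rpos, 0 ≤ κ β := fun β hβ => hκ.nonneg β (hRpos.subset hβ)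
  set r := (Submodule.span ℝ {α})ᗮ.reflection with hr
  set F : E → 𝕜 := fun x =>
    (inner ℝ α x / (inner ℝ α x ^ 2 + ε) * gaussWeight Rpos κ ε x) • evalAt x p with hF
  have hi : Integrable F := by
    refine (integrable_gaussWeight_smul hnn hε.le
      ((polyBounded_div_sq_add hε α).smul (polyBounded_evalAt p))
      ((continuous_div_sq_add hε α).smul (continuous_evalAt p))).congr
        (Eventually.of_forall fun x => ?_)
    simp only [hF, smul_smul, mul_comm]
  have hmp : MeasurePreserving r := r.measurePreserving
  have hFr : ∫ x, F (r x) = ∫ x, F x :=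
    hmp.integral_comp r.toHomeomorph.measurableEmbedding F
  have hi' : Integrable (fun x => F (r x)) := hmp.integrable_comp_of_integrable hi
  rw [two_mul]
  nth_rw 2 [← hFr]
  rw [← integral_add hi hi']
  refine integral_congr_ae (Eventually.of_forall fun x => ?_)
  have hneg : (inner ℝ α (r x) : ℝ) = -inner ℝ α x := by
    rw [hr, inner_reflection_left, reflection_orthogonal_self, inner_neg_left]
  simp only [hF, hneg]
  rw [gaussWeight_reflection hR hRpos hκ hε.le hα, neg_sq, neg_div, neg_mul, neg_smul,
    ← sub_eq_add_neg, ← smul_sub, evalAt_sub_reflection, smul_smul]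
  congr 1
  ring

/-- Integration by parts moves `∂_ξ` onto the weight: the Gaussian contributes `⟨ξ, x⟩` and each
root a singular-looking term, which symmetrisation under `r_α` converts to a difference quotient. -/
theorem integral_gaussWeight_pderiv (hR : IsReducedRootSystem R)
    (hRpos : IsPositiveSystem R Rpos) (hκ : IsMultiplicityFunction R κ) {ε : ℝ} (hε : 0 < ε)
    (ξ : E) (p : MvPolynomial (Fin d) 𝕜) :
    (∫ x : E, gaussWeight Rpos κ ε x • evalAt x (∑ i, C ((ξ i : ℝ) : 𝕜) * pderiv i p)) +
      ∑ α ∈ Rpos, ((κ α * inner ℝ α ξ : ℝ) : 𝕜) *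
        ∫ x : E, (inner ℝ α x ^ 2 / (inner ℝ α x ^ 2 + ε) * gaussWeight Rpos κ ε x) •
          evalAt x (diffQuotient α p) =
      ∫ x : E, gaussWeight Rpos κ ε x • evalAt x (linForm 𝕜 ξ * p) := by
  have hnn : ∀ β ∈ Rpos, 0 ≤ κ β := fun β hβ => hκ.nonneg β (hRpos.subset hβ)
  have hint : ∀ q : MvPolynomial (Fin d) 𝕜,
      Integrable (fun x : E => gaussWeight Rpos κ ε x • evalAt x q) := fun q =>
    integrable_gaussWeight_smul hnn hε.le (polyBounded_evalAt q) (continuous_evalAt q)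
  have hint2 : ∀ α : E, Integrable (fun x : E =>
      (inner ℝ α x / (inner ℝ α x ^ 2 + ε) * gaussWeight Rpos κ ε x) • evalAt x p) := by
    intro α
    refine (integrable_gaussWeight_smul hnn hε.le
      ((polyBounded_div_sq_add hε α).smul (polyBounded_evalAt p))
      ((continuous_div_sq_add hε α).smul (continuous_evalAt p))).congr
        (Eventually.of_forall fun x => ?_)
    simp only [smul_smul, mul_comm]
  have hexp : ∀ x : E, ((∑ α ∈ Rpos, 2 * (κ α * inner ℝ α ξ) *
      (inner ℝ α x / (inner ℝ α x ^ 2 + ε)) - inner ℝ ξ x) * gaussWeight Rpos κ ε x) •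
        evalAt x p = (∑ α ∈ Rpos, ((2 * (κ α * inner ℝ α ξ) : ℝ) : 𝕜) *
          (inner ℝ α x / (inner ℝ α x ^ 2 + ε) * gaussWeight Rpos κ ε x) • evalAt x p) -
          gaussWeight Rpos κ ε x • evalAt x (linForm 𝕜 ξ * p) := by
    intro x
    simp only [evalAt_mul, evalAt_linForm, RCLike.real_smul_eq_coe_mul]
    push_cast
    rw [sub_mul, sub_mul, Finset.sum_mul, Finset.sum_mul]
    congr 1
    · exact Finset.sum_congr rfl fun α _ => by ring
    · ring
  have hsumint : Integrable (fun x : E => ∑ α ∈ Rpos, ((2 * (κ α * inner ℝ α ξ) : ℝ) : 𝕜) *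
          (inner ℝ α x / (inner ℝ α x ^ 2 + ε) * gaussWeight Rpos κ ε x) • evalAt x p) :=
    integrable_finsetSum _ fun α _ => (hint2 α).const_mul _
  have key := integral_bilinear_hasLineDerivAt_right_eq_neg_left_of_integrable
    (μ := (volume : Measure E)) (f := gaussWeight Rpos κ ε) (g := fun x : E => evalAt x p) (v := ξ)
    (g' := fun x => evalAt x (∑ i, C ((ξ i : ℝ) : 𝕜) * pderiv i p))
    (f' := fun x => (∑ α ∈ Rpos, 2 * (κ α * inner ℝ α ξ) *
      (inner ℝ α x / (inner ℝ α x ^ 2 + ε)) - inner ℝ ξ x) * gaussWeight Rpos κ ε x)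
    (B := ContinuousLinearMap.lsmul ℝ ℝ)
    (by
      simp only [ContinuousLinearMap.lsmul_apply, hexp]
      exact hsumint.sub (hint _))
    (by simpa only [ContinuousLinearMap.lsmul_apply] using hint _)
    (by simpa only [ContinuousLinearMap.lsmul_apply] using hint _)
    (fun x _ => hasLineDerivAt_gaussWeight Rpos κ hε x ξ)
    (fun x _ => hasLineDerivAt_evalAt p x ξ)
  simp only [ContinuousLinearMap.lsmul_apply, hexp] at key
  rw [integral_sub hsumint (hint _), integral_finsetSum _ fun α _ => (hint2 α).const_mul _] at key
  rw [key, neg_sub, sub_add_eq_add_sub, sub_eq_iff_eq_add]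
  congr 1
  refine Finset.sum_congr rfl fun α hα => ?_
  rw [← two_mul_integral_div_sq_add hR hRpos hκ hε (hRpos.subset hα), integral_const_mul]
  push_cast
  ring

/-! ### The limit `ε → 0` and the adjoint formula for Dunkl operators -/

theorem ae_inner_ne_zero {α : E} (hα : α ≠ 0) : ∀ᵐ x : E, (inner ℝ α x : ℝ) ≠ 0 := by
  have h : (Submodule.span ℝ {α})ᗮ ≠ ⊤ := by
    rw [Ne, Submodule.orthogonal_eq_top_iff, Submodule.span_singleton_eq_bot]
    exact hα
  have h2 := Measure.addHaar_submodule (volume : Measure E) _ h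
  rw [ae_iff]
  refine measure_mono_null (fun x hx => ?_) h2
  simpa [Submodule.mem_orthogonal_singleton_iff_inner_right] using hx

/-- Dominated convergence. The factor `φ` serves both limits needed: `φ = 1`, and `⟨α, x⟩² / (⟨α,
x⟩² + ε)`, which tends to `1` only off a null hyperplane. -/
theorem tendsto_integral_gaussWeight {S : Finset (EuclideanSpace ℝ (Fin d))}
    (hκ : ∀ α ∈ S, 0 ≤ κ α) (φ : ℝ → E → ℝ)
    (hφc : ∀ ε > 0, Continuous (φ ε)) (hφ1 : ∀ ε > 0, ∀ x, |φ ε x| ≤ 1)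
    (hφ : ∀ᵐ x, Tendsto (fun ε => φ ε x) (𝓝[>] 0) (𝓝 1)) (p : MvPolynomial (Fin d) 𝕜) :
    Tendsto (fun ε => ∫ x : E, (φ ε x * gaussWeight S κ ε x) • evalAt x p) (𝓝[>] 0)
      (𝓝 (∫ x : E, gaussWeight S κ 0 x • evalAt x p)) := by
  refine tendsto_integral_filter_of_dominated_convergence
    (fun x : E => ‖gaussWeight S κ 1 x • evalAt x p‖) ?_ ?_ ?_ ?_
  · filter_upwards [self_mem_nhdsWithin] with ε hε
    exact (((hφc ε hε).mul (continuous_gaussWeight hκ ε)).smul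
      (continuous_evalAt p)).aestronglyMeasurable
  · filter_upwards [Ioo_mem_nhdsGT (zero_lt_one' ℝ)] with ε hε
    refine Eventually.of_forall fun x => ?_
    rw [norm_smul, norm_smul, norm_mul]
    gcongr
    rw [Real.norm_of_nonneg (gaussWeight_nonneg S κ hε.1.le x),
      Real.norm_of_nonneg (gaussWeight_nonneg S κ zero_le_one x), Real.norm_eq_abs]
    calc |φ ε x| * gaussWeight S κ ε x ≤ 1 * gaussWeight S κ ε x :=
          mul_le_mul_of_nonneg_right (hφ1 ε hε.1 x) (gaussWeight_nonneg S κ hε.1.le x)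
      _ ≤ _ := by
        rw [one_mul]
        exact mul_le_mul_of_nonneg_right (regWeight_mono hκ hε.1.le hε.2.le x) (Real.exp_pos _).le
  · exact (integrable_gaussWeight_smul hκ zero_le_one (polyBounded_evalAt p)
      (continuous_evalAt p)).norm
  · filter_upwards [hφ] with x hx
    have := (hx.mul ((tendsto_regWeight hκ x).mul_const (Real.exp (-‖x‖ ^ 2 / 2)))).smul_const
      (evalAt x p)
    simpa only [one_mul, gaussWeight] using this

/-- Gaussian integral of a polynomial against the squared Dunkl weight. -/
noncomputable def gaussIntegral (Rpos : Finset E) (κ : E → ℝ) (p : MvPolynomial (Fin d) 𝕜) : 𝕜 :=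
  ∫ x : E, gaussWeight Rpos κ 0 x • evalAt x p

theorem integrable_gauss (hRpos : IsPositiveSystem R Rpos) (hκ : IsMultiplicityFunction R κ)
    (p : MvPolynomial (Fin d) 𝕜) :
    Integrable (fun x : E => gaussWeight Rpos κ 0 x • evalAt x p) :=
  integrable_gaussWeight_smul (fun β hβ => hκ.nonneg β (hRpos.subset hβ)) le_rfl
    (polyBounded_evalAt p) (continuous_evalAt p)

theorem gaussIntegral_add (hRpos : IsPositiveSystem R Rpos) (hκ : IsMultiplicityFunction R κ)
    (p q : MvPolynomial (Fin d) 𝕜) :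
    gaussIntegral Rpos κ (p + q) = gaussIntegral Rpos κ p + gaussIntegral Rpos κ q := by
  unfold gaussIntegral
  rw [← integral_add (integrable_gauss hRpos hκ p) (integrable_gauss hRpos hκ q)]
  simp only [evalAt_add, smul_add]

theorem gaussIntegral_C_mul (a : 𝕜) (p : MvPolynomial (Fin d) 𝕜) :
    gaussIntegral Rpos κ (C a * p) = a * gaussIntegral Rpos κ p := by
  unfold gaussIntegral
  rw [← integral_const_mul]
  simp only [evalAt_mul, evalAt_C, mul_smul_comm]

theorem gaussIntegral_sum (hRpos : IsPositiveSystem R Rpos) (hκ : IsMultiplicityFunction R κ)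
    {ι : Type*} (s : Finset ι) (p : ι → MvPolynomial (Fin d) 𝕜) :
    gaussIntegral Rpos κ (∑ i ∈ s, p i) = ∑ i ∈ s, gaussIntegral Rpos κ (p i) := by
  unfold gaussIntegral
  rw [← integral_finsetSum _ fun i _ => integrable_gauss hRpos hκ (p i)]
  simp only [evalAt_sum, Finset.smul_sum]

theorem gaussIntegral_reflectPoly (hR : IsReducedRootSystem R)
    (hRpos : IsPositiveSystem R Rpos) (hκ : IsMultiplicityFunction R κ) {α : E} (hα : α ∈ R)
    (p : MvPolynomial (Fin d) 𝕜) :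
    gaussIntegral Rpos κ (reflectPoly α p) = gaussIntegral Rpos κ p := by
  set r := (Submodule.span ℝ {α})ᗮ.reflection with hr
  have hmp : MeasurePreserving r := r.measurePreserving
  unfold gaussIntegral
  rw [← hmp.integral_comp r.toHomeomorph.measurableEmbedding]
  simp only [evalAt_reflectPoly, ← hr]
  refine integral_congr_ae (Eventually.of_forall fun x => ?_)
  simp only [hr, gaussWeight_reflection hR hRpos hκ le_rfl hα, Submodule.reflection_reflection]

/-- The Dunkl operator is adjoint to the operator it forms with multiplication by `⟨ξ, x⟩`. -/
theorem gaussIntegral_dunklOp (hR : IsReducedRootSystem R)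
    (hRpos : IsPositiveSystem R Rpos) (hκ : IsMultiplicityFunction R κ) (ξ : E)
    (p : MvPolynomial (Fin d) 𝕜) :
    gaussIntegral Rpos κ (dunklOp Rpos κ ξ p) = gaussIntegral Rpos κ (linForm 𝕜 ξ * p) := by
  have hnn : ∀ β ∈ Rpos, 0 ≤ κ β := fun β hβ => hκ.nonneg β (hRpos.subset hβ)
  have hone : ∀ q : MvPolynomial (Fin d) 𝕜, Tendsto
      (fun ε => ∫ x : E, gaussWeight Rpos κ ε x • evalAt x q) (𝓝[>] 0)
      (𝓝 (gaussIntegral Rpos κ q)) := fun q => by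
    simpa [gaussIntegral] using tendsto_integral_gaussWeight hnn (fun _ _ => 1) (fun _ _ => continuous_const)
      (by simp) (Eventually.of_forall fun x => tendsto_const_nhds) q
  have hfrac : ∀ α ∈ Rpos, Tendsto (fun ε =>
      ∫ x : E, (inner ℝ α x ^ 2 / (inner ℝ α x ^ 2 + ε) * gaussWeight Rpos κ ε x) •
        evalAt x (diffQuotient α p)) (𝓝[>] 0) (𝓝 (gaussIntegral Rpos κ (diffQuotient α p))) := by
    intro α hα
    refine tendsto_integral_gaussWeight hnn
      (fun ε x => inner ℝ α x ^ 2 / (inner ℝ α x ^ 2 + ε)) ?_ ?_ ?_ _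
    · exact fun ε hε => Continuous.div (by fun_prop) (by fun_prop) fun x => by positivity
    · intro ε hε x
      rw [abs_of_nonneg (by positivity), div_le_one (by positivity)]
      linarith
    · filter_upwards [ae_inner_ne_zero (hR.ne_zero α (hRpos.subset hα))] with x hx
      have hx2 : (inner ℝ α x : ℝ) ^ 2 ≠ 0 := pow_ne_zero 2 hx
      have : ContinuousAt (fun ε : ℝ => (inner ℝ α x : ℝ) ^ 2 / (inner ℝ α x ^ 2 + ε)) 0 :=
        ContinuousAt.div (by fun_prop) (by fun_prop) (by simpa using hx2)
      have h := this.tendsto.mono_left (nhdsWithin_le_nhds (s := Set.Ioi 0))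
      simpa [div_self hx2] using h
  have hlim := (hone (∑ i, C ((ξ i : ℝ) : 𝕜) * pderiv i p)).add
    (tendsto_finsetSum Rpos fun α hα => (hfrac α hα).const_mul ((κ α * inner ℝ α ξ : ℝ) : 𝕜))
  have hlim2 := hone (linForm 𝕜 ξ * p)
  have heq := tendsto_nhds_unique_of_eventuallyEq hlim hlim2 (by
    filter_upwards [self_mem_nhdsWithin] with ε hε
    exact integral_gaussWeight_pderiv hR hRpos hκ hε ξ p)
  rw [← heq, dunklOp, gaussIntegral_add hRpos hκ, gaussIntegral_sum hRpos hκ Rpos]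
  simp only [gaussIntegral_C_mul]

end RootSystem

/-! ### Dunkl operators on homogeneous polynomials -/

theorem linForm_ne_zero {α : E} (hα : α ≠ 0) : linForm 𝕜 α ≠ 0 := by
  intro h
  have h1 := evalAt_linForm (𝕜 := 𝕜) α α
  rw [h] at h1
  have h2 : ((inner ℝ α α : ℝ) : 𝕜) = 0 := by rw [← h1]; simp [evalAt]
  rw [RCLike.ofReal_eq_zero, inner_self_eq_zero] at h2
  exact hα h2

theorem linForm_isHomogeneous (α : E) : (linForm 𝕜 α).IsHomogeneous 1 :=
  IsHomogeneous.sum _ _ _ fun _ _ => isHomogeneous_C_mul_X _ _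

theorem linForm_single (j : Fin d) : linForm 𝕜 (EuclideanSpace.single j (1 : ℝ)) = X j := by
  unfold linForm
  rw [Finset.sum_eq_single j]
  · simp
  · intro i _ hij
    simp [hij]
  · simp

theorem reflectPoly_isHomogeneous (α : E) {p : MvPolynomial (Fin d) 𝕜} {n : ℕ}
    (hp : p.IsHomogeneous n) : (reflectPoly α p).IsHomogeneous n := by
  have := hp.aeval (n := 1)
    (fun i => X i - C ((2 * α i / ‖α‖ ^ 2 : ℝ) : 𝕜) * linForm 𝕜 α)
    (fun i => (isHomogeneous_X 𝕜 i).sub ((linForm_isHomogeneous α).C_mul _))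
  rwa [one_mul] at this

/-- The quotient is a chosen witness of divisibility; its algebraic properties all come from
cancelling the nonzero linear form. -/
theorem diffQuotient_unique {α : E} (hα : α ≠ 0) {p q : MvPolynomial (Fin d) 𝕜}
    (h : linForm 𝕜 α * q = p - reflectPoly α p) : diffQuotient α p = q :=
  mul_left_cancel₀ (linForm_ne_zero hα) ((linForm_mul_diffQuotient α p).trans h.symm)

theorem diffQuotient_add {α : E} (hα : α ≠ 0) (p q : MvPolynomial (Fin d) 𝕜) :
    diffQuotient α (p + q) = diffQuotient α p + diffQuotient α q := by
  apply diffQuotient_unique hα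
  rw [mul_add, linForm_mul_diffQuotient, linForm_mul_diffQuotient]
  simp only [reflectPoly, map_add]
  ring

theorem diffQuotient_C {α : E} (hα : α ≠ 0) (a : 𝕜) :
    diffQuotient α (C a : MvPolynomial (Fin d) 𝕜) = 0 := by
  apply diffQuotient_unique hα
  simp [reflectPoly]

theorem homogeneousComponent_mul_of_isHomogeneous {σ S : Type*} [CommSemiring S]
    {p q : MvPolynomial σ S} {m n : ℕ} (hp : p.IsHomogeneous m) :
    homogeneousComponent (m + n) (p * q) = p * homogeneousComponent n q := by
  let := MvPolynomial.gradedAlgebra (σ := σ) (R := S)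
  have := DirectSum.coe_decompose_mul_add_of_left_mem (homogeneousSubmodule σ S) (j := n) (b := q)
    ((mem_homogeneousSubmodule m p).2 hp)
  rw [← decomposition.decompose'_apply, ← decomposition.decompose'_apply]
  exact this

/-- The degree `n` component of the quotient solves the same division equation, so uniqueness
identifies it with the quotient. -/
theorem diffQuotient_isHomogeneous {α : E} (hα : α ≠ 0) {p : MvPolynomial (Fin d) 𝕜} {n : ℕ}
    (hp : p.IsHomogeneous (n + 1)) : (diffQuotient α p).IsHomogeneous n := by
  have h : diffQuotient α p = homogeneousComponent n (diffQuotient α p) := by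
    apply diffQuotient_unique hα
    rw [← homogeneousComponent_mul_of_isHomogeneous (linForm_isHomogeneous α),
      linForm_mul_diffQuotient, add_comm]
    exact homogeneousComponent_eq_self (hp.sub (reflectPoly_isHomogeneous α hp))
  rw [h]
  exact homogeneousComponent_isHomogeneous _ _

theorem isHomogeneous_zero_eq_C {p : MvPolynomial (Fin d) 𝕜} (hp : p.IsHomogeneous 0) :
    p = C (evalAt 0 p) := by
  rw [← totalDegree_zero_iff_isHomogeneous, totalDegree_eq_zero_iff_eq_C] at hp
  rw [hp]
  simp

section

variable {Rpos : Finset (EuclideanSpace ℝ (Fin d))} {κ : EuclideanSpace ℝ (Fin d) → ℝ}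

theorem dunklOp_add (h0 : ∀ α ∈ Rpos, α ≠ 0) (ξ : E) (p q : MvPolynomial (Fin d) 𝕜) :
    dunklOp Rpos κ ξ (p + q) = dunklOp Rpos κ ξ p + dunklOp Rpos κ ξ q := by
  unfold dunklOp
  have h : ∑ α ∈ Rpos, C ((κ α * inner ℝ α ξ : ℝ) : 𝕜) * diffQuotient α (p + q) =
      ∑ α ∈ Rpos, C ((κ α * inner ℝ α ξ : ℝ) : 𝕜) * (diffQuotient α p + diffQuotient α q) :=
    Finset.sum_congr rfl fun α hα => by rw [diffQuotient_add (h0 α hα)]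
  rw [h]
  simp only [map_add, mul_add, Finset.sum_add_distrib]
  ring

theorem dunklOp_C (h0 : ∀ α ∈ Rpos, α ≠ 0) (ξ : E) (a : 𝕜) :
    dunklOp Rpos κ ξ (C a : MvPolynomial (Fin d) 𝕜) = 0 := by
  unfold dunklOp
  rw [Finset.sum_eq_zero (s := Rpos) fun α hα => by rw [diffQuotient_C (h0 α hα), mul_zero]]
  simp

theorem dunklOp_isHomogeneous (h0 : ∀ α ∈ Rpos, α ≠ 0) (ξ : E) {p : MvPolynomial (Fin d) 𝕜}
    {n : ℕ} (hp : p.IsHomogeneous (n + 1)) : (dunklOp Rpos κ ξ p).IsHomogeneous n :=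
  (IsHomogeneous.sum _ _ _ fun _ _ => hp.pderiv.C_mul _).add
    (IsHomogeneous.sum _ _ _ fun α hα => (diffQuotient_isHomogeneous (h0 α hα) hp).C_mul _)

theorem dunklLaplacian_add (h0 : ∀ α ∈ Rpos, α ≠ 0) (p q : MvPolynomial (Fin d) 𝕜) :
    dunklLaplacian Rpos κ (p + q) = dunklLaplacian Rpos κ p + dunklLaplacian Rpos κ q := by
  simp only [dunklLaplacian, dunklOp_add h0, Finset.sum_add_distrib]

theorem dunklLaplacian_C (h0 : ∀ α ∈ Rpos, α ≠ 0) (a : 𝕜) :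
    dunklLaplacian Rpos κ (C a : MvPolynomial (Fin d) 𝕜) = 0 := by
  have h := fun ξ => dunklOp_C (κ := κ) h0 ξ (0 : 𝕜)
  rw [map_zero] at h
  simp only [dunklLaplacian, dunklOp_C h0, h, Finset.sum_const_zero]

theorem dunklLaplacian_zero (h0 : ∀ α ∈ Rpos, α ≠ 0) :
    dunklLaplacian Rpos κ (0 : MvPolynomial (Fin d) 𝕜) = 0 := by
  simpa using dunklLaplacian_C (κ := κ) h0 (0 : 𝕜)

theorem iterate_dunklLaplacian_add (h0 : ∀ α ∈ Rpos, α ≠ 0) (l : ℕ)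
    (p q : MvPolynomial (Fin d) 𝕜) :
    (dunklLaplacian Rpos κ)^[l] (p + q) =
      (dunklLaplacian Rpos κ)^[l] p + (dunklLaplacian Rpos κ)^[l] q := by
  induction l generalizing p q with
  | zero => rfl
  | succ l ih => rw [Function.iterate_succ_apply, dunklLaplacian_add h0, ih]; rfl

theorem iterate_dunklLaplacian_zero (h0 : ∀ α ∈ Rpos, α ≠ 0) (l : ℕ) :
    (dunklLaplacian Rpos κ)^[l] (0 : MvPolynomial (Fin d) 𝕜) = 0 :=
  Function.iterate_fixed (dunklLaplacian_zero h0) l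

theorem dunklLaplacian_isHomogeneous (h0 : ∀ α ∈ Rpos, α ≠ 0) {p : MvPolynomial (Fin d) 𝕜}
    {n : ℕ} (hp : p.IsHomogeneous (n + 2)) : (dunklLaplacian Rpos κ p).IsHomogeneous n :=
  IsHomogeneous.sum _ _ _ fun _ _ =>
    dunklOp_isHomogeneous h0 _ (dunklOp_isHomogeneous h0 _ hp)

theorem dunklLaplacian_eq_zero_of_isHomogeneous_one (h0 : ∀ α ∈ Rpos, α ≠ 0)
    {p : MvPolynomial (Fin d) 𝕜} (hp : p.IsHomogeneous 1) : dunklLaplacian Rpos κ p = 0 := by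
  refine Finset.sum_eq_zero fun j _ => ?_
  rw [isHomogeneous_zero_eq_C (dunklOp_isHomogeneous h0 (EuclideanSpace.single j 1) hp),
    dunklOp_C h0]

theorem evalAt_smul_of_isHomogeneous {p : MvPolynomial (Fin d) 𝕜} {n : ℕ}
    (hp : p.IsHomogeneous n) (r : ℝ) (x : E) :
    evalAt (r • x) p = ((r ^ n : ℝ) : 𝕜) * evalAt x p := by
  unfold evalAt
  rw [eval_eq', eval_eq', Finset.mul_sum]
  refine Finset.sum_congr rfl fun m hm => ?_
  have hdeg : ∑ i, m i = n := by
    rw [hp.degree_eq_sum_deg_support hm]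
    exact (Finset.sum_subset (Finset.subset_univ _) (by simp)).symm
  have : ∏ i, (((r • x) i : ℝ) : 𝕜) ^ m i = ((r ^ n : ℝ) : 𝕜) * ∏ i, ((x i : ℝ) : 𝕜) ^ m i := by
    rw [← hdeg, ← Finset.prod_pow_eq_pow_sum]
    push_cast
    rw [← Finset.prod_mul_distrib]
    refine Finset.prod_congr rfl fun i _ => ?_
    simp [mul_pow]
  rw [this]
  ring

theorem evalAt_zero_of_isHomogeneous {p : MvPolynomial (Fin d) 𝕜} {n : ℕ}
    (hp : p.IsHomogeneous n) (hn : n ≠ 0) : evalAt 0 p = 0 := by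
  have := evalAt_smul_of_isHomogeneous hp 0 0
  simpa [hn] using this

/-- Each `Δ_κ` lowers the degree by two and kills degrees `0` and `1`; a nonzero constant can remain
after `l` steps only from degree `2l`. -/
theorem evalAt_zero_iterate_dunklLaplacian (h0 : ∀ α ∈ Rpos, α ≠ 0)
    {p : MvPolynomial (Fin d) 𝕜} {n l : ℕ} (hp : p.IsHomogeneous n) (hn : n ≠ 2 * l) :
    evalAt 0 ((dunklLaplacian Rpos κ)^[l] p) = 0 := by
  induction l generalizing n p with
  | zero => exact evalAt_zero_of_isHomogeneous hp hn
  | succ l ih =>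
    rw [Function.iterate_succ_apply]
    match n, hp, hn with
    | 0, hp, _ =>
      rw [isHomogeneous_zero_eq_C hp, dunklLaplacian_C h0, iterate_dunklLaplacian_zero h0]
      simp [evalAt]
    | 1, hp, _ =>
      rw [dunklLaplacian_eq_zero_of_isHomogeneous_one h0 hp, iterate_dunklLaplacian_zero h0]
      simp [evalAt]
    | n + 2, hp, hn => exact ih (dunklLaplacian_isHomogeneous h0 hp) (by omega)

/-! ### Euler's identity and Gaussian integrals of homogeneous polynomials -/

/-- Euler's identity handles the derivatives; in the other terms `∑ x_j ⟨α, e_j⟩ = ⟨α, x⟩` cancels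
the denominator. -/
theorem sum_X_mul_dunklOp {p : MvPolynomial (Fin d) 𝕜} {n : ℕ} (hp : p.IsHomogeneous n) :
    ∑ j, X j * dunklOp Rpos κ (EuclideanSpace.single j 1) p =
      n • p + ∑ α ∈ Rpos, C ((κ α : ℝ) : 𝕜) * (p - reflectPoly α p) := by
  rw [← hp.sum_X_mul_pderiv]
  unfold dunklOp
  simp only [mul_add, Finset.sum_add_distrib]
  congr 1
  · refine Finset.sum_congr rfl fun j _ => ?_
    rw [Finset.sum_eq_single j]
    · simp
    · intro i _ hij
      simp [hij]
    · simp
  · simp only [Finset.mul_sum]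
    rw [Finset.sum_comm]
    refine Finset.sum_congr rfl fun α _ => ?_
    rw [← linForm_mul_diffQuotient, linForm, Finset.sum_mul, Finset.mul_sum]
    refine Finset.sum_congr rfl fun j _ => ?_
    rw [EuclideanSpace.inner_single_right]
    simp
    ring

variable {R : Finset (EuclideanSpace ℝ (Fin d))}

/-- The adjoint formula turns the outer `D_j` into multiplication by `x_j`. The terms `p - p ∘ r_α`
left by Euler's identity integrate to zero by invariance. -/
theorem gaussIntegral_dunklLaplacian (hR : IsReducedRootSystem R)
    (hRpos : IsPositiveSystem R Rpos) (hκ : IsMultiplicityFunction R κ)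
    {p : MvPolynomial (Fin d) 𝕜} {n : ℕ} (hp : p.IsHomogeneous n) :
    gaussIntegral Rpos κ (dunklLaplacian Rpos κ p) = n * gaussIntegral Rpos κ p := by
  rw [dunklLaplacian, gaussIntegral_sum hRpos hκ]
  simp only [gaussIntegral_dunklOp hR hRpos hκ, linForm_single]
  have hn : (n • p : MvPolynomial (Fin d) 𝕜) = C (n : 𝕜) * p := by simp
  rw [← gaussIntegral_sum hRpos hκ, sum_X_mul_dunklOp hp, gaussIntegral_add hRpos hκ,
    gaussIntegral_sum hRpos hκ, Finset.sum_eq_zero, add_zero, hn, gaussIntegral_C_mul]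
  intro α hα
  have h1 : p - reflectPoly α p + reflectPoly α p = p := sub_add_cancel _ _
  have h2 := gaussIntegral_add hRpos hκ (p - reflectPoly α p) (reflectPoly α p)
  rw [h1, gaussIntegral_reflectPoly hR hRpos hκ (hRpos.subset hα), right_eq_add] at h2
  rw [gaussIntegral_C_mul, h2, mul_zero]

theorem IsPositiveSystem.ne_zero (hR : IsReducedRootSystem R) (hRpos : IsPositiveSystem R Rpos) :
    ∀ α ∈ Rpos, α ≠ 0 := fun α hα => hR.ne_zero α (hRpos.subset hα)

theorem gaussIntegral_of_isHomogeneous_even (hR : IsReducedRootSystem R)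
    (hRpos : IsPositiveSystem R Rpos) (hκ : IsMultiplicityFunction R κ) (m : ℕ)
    {p : MvPolynomial (Fin d) 𝕜} (hp : p.IsHomogeneous (2 * m)) :
    2 ^ m * m.factorial * gaussIntegral Rpos κ p =
      evalAt 0 ((dunklLaplacian Rpos κ)^[m] p) *
        gaussIntegral Rpos κ (1 : MvPolynomial (Fin d) 𝕜) := by
  induction m generalizing p with
  | zero =>
    nth_rw 1 [isHomogeneous_zero_eq_C hp]
    rw [← mul_one (C _), gaussIntegral_C_mul]
    simp
  | succ m ih =>
    have h := ih (dunklLaplacian_isHomogeneous (κ := κ) (hRpos.ne_zero hR) hp)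
    rw [gaussIntegral_dunklLaplacian hR hRpos hκ hp] at h
    rw [Function.iterate_succ_apply, ← h, Nat.factorial_succ]
    push_cast
    ring

theorem gaussIntegral_of_isHomogeneous_odd (hR : IsReducedRootSystem R)
    (hRpos : IsPositiveSystem R Rpos) (hκ : IsMultiplicityFunction R κ) (m : ℕ)
    {p : MvPolynomial (Fin d) 𝕜} (hp : p.IsHomogeneous (2 * m + 1)) :
    gaussIntegral Rpos κ p = 0 := by
  have hne : ((2 * m + 1 : ℕ) : 𝕜) ≠ 0 := Nat.cast_ne_zero.2 (Nat.succ_ne_zero _)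
  refine (mul_eq_zero.1 ?_).resolve_left hne
  -- The induction runs on the integral of `Δ_κ p`, whose base case is `Δ_κ p = 0` in degree `1`.
  rw [← gaussIntegral_dunklLaplacian hR hRpos hκ hp]
  clear hne
  induction m generalizing p with
  | zero =>
    rw [dunklLaplacian_eq_zero_of_isHomogeneous_one (hRpos.ne_zero hR) hp]
    simp [gaussIntegral, evalAt]
  | succ m ih =>
    have hp' := dunklLaplacian_isHomogeneous (κ := κ) (hRpos.ne_zero hR) hp
    have hk := gaussIntegral_dunklLaplacian hR hRpos hκ hp'
    have hne : ((2 * m + 1 : ℕ) : 𝕜) ≠ 0 := Nat.cast_ne_zero.2 (Nat.succ_ne_zero _)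
    rw [ih hp'] at hk
    exact (mul_eq_zero.1 hk.symm).resolve_left hne

end

/-! ### Polar coordinates -/

section

variable {R Rpos : Finset (EuclideanSpace ℝ (Fin d))} {κ : EuclideanSpace ℝ (Fin d) → ℝ}

theorem integral_volumeIoiPow {F : Type*} [NormedAddCommGroup F] [NormedSpace ℝ F] (n : ℕ)
    (f : ℝ → F) :
    ∫ r : Set.Ioi (0 : ℝ), f r ∂(Measure.volumeIoiPow n) =
      ∫ r in Set.Ioi (0 : ℝ), r ^ n • f r := by
  simp only [Measure.volumeIoiPow, ENNReal.ofReal]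
  rw [integral_withDensity_eq_integral_smul,
    integral_subtype_comap measurableSet_Ioi fun a ↦ Real.toNNReal (a ^ n) • f a,
    setIntegral_congr_fun measurableSet_Ioi fun x hx ↦ ?_]
  · rw [NNReal.smul_def, Real.coe_toNNReal _ (pow_nonneg hx.out.le _)]
  · exact (measurable_subtype_coe.pow_const _).real_toNNReal

theorem integral_eq_sphere_mul_radial [Nontrivial E] (F : E → 𝕜)
    (A : Metric.sphere (0 : E) 1 → 𝕜) (B : ℝ → ℝ)
    (h : ∀ (ω : Metric.sphere (0 : E) 1) (r : ℝ), 0 < r → F (r • (ω : E)) = A ω * (B r : 𝕜)) :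
    ∫ x, F x = (∫ ω, A ω ∂(surfaceMeasure d)) *
      ((∫ r in Set.Ioi (0 : ℝ), r ^ (d - 1) * B r : ℝ) : 𝕜) := by
  calc ∫ x, F x = ∫ x : ({(0)}ᶜ : Set E), F x.1 ∂((volume : Measure E).comap (↑)) := by
        rw [integral_subtype_comap (measurableSet_singleton _).compl F, restrict_compl_singleton]
    _ = ∫ z : Metric.sphere (0 : E) 1 × Set.Ioi (0 : ℝ), A z.1 * (B z.2 : 𝕜)
        ∂((volume : Measure E).toSphere.prod (.volumeIoiPow (Module.finrank ℝ E - 1))) := by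
        rw [← (volume : Measure E).measurePreserving_homeomorphUnitSphereProd.integral_comp
          (Homeomorph.measurableEmbedding _)]
        refine integral_congr_ae (Eventually.of_forall fun x => ?_)
        have hx := h (homeomorphUnitSphereProd E x).1 (homeomorphUnitSphereProd E x).2
          (homeomorphUnitSphereProd E x).2.2
        dsimp only
        rw [← hx]
        congr 1
        have hx0 : ‖(x : E)‖ ≠ 0 := norm_ne_zero_iff.2 x.2
        simp [smul_smul, hx0]
    _ = (∫ ω, A ω ∂(surfaceMeasure d)) *
        ∫ r : Set.Ioi (0 : ℝ), (B r : 𝕜) ∂(Measure.volumeIoiPow (d - 1)) := by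
        rw [finrank_euclideanSpace_fin]
        exact integral_prod_mul A fun r : Set.Ioi (0 : ℝ) => (B r : 𝕜)
    _ = _ := by
        rw [integral_volumeIoiPow (d - 1) fun r => (B r : 𝕜), ← integral_ofReal]
        simp only [RCLike.real_smul_eq_coe_mul]
        push_cast
        rfl

theorem dunklWeight_smul (S : Finset (EuclideanSpace ℝ (Fin d)))
    (κ : EuclideanSpace ℝ (Fin d) → ℝ) {r : ℝ} (hr : 0 < r) (x : E) :
    dunklWeight S κ (r • x) = r ^ (∑ α ∈ S, κ α) * dunklWeight S κ x := by
  unfold dunklWeight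
  rw [Real.rpow_sum_of_pos hr, ← Finset.prod_mul_distrib]
  refine Finset.prod_congr rfl fun α _ => ?_
  rw [inner_smul_right, abs_mul, abs_of_pos hr, Real.mul_rpow hr.le (abs_nonneg _)]

/-- `λ_κ` itself can be negative when `d = 1`, but `λ_κ + 1 = ∑ κ_α + d/2`; this keeps the Gamma
values positive. -/
theorem dunklIndex_add_one_pos (hd : 0 < d) (hκ : ∀ α ∈ Rpos, 0 ≤ κ α) :
    0 < dunklIndex Rpos κ + 1 := by
  have h1 : 0 ≤ ∑ α ∈ Rpos, κ α := Finset.sum_nonneg hκ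
  have h2 : (0 : ℝ) < d := by exact_mod_cast hd
  unfold dunklIndex
  linarith

/-- With `a = λ_κ + n/2`, the total power of `r` is `2a + 1`, and `∫ r^{2a+1} e^{-r²/2} dr = 2^a Γ(a
+ 1)` over `(0, ∞)`. -/
theorem gaussIntegral_eq_sphereIntegral (hd : 0 < d) (hκ : ∀ α ∈ Rpos, 0 ≤ κ α)
    {p : MvPolynomial (Fin d) 𝕜} {n : ℕ} (hp : p.IsHomogeneous n) :
    gaussIntegral Rpos κ p = sphereIntegral Rpos κ p *
      ((2 ^ (dunklIndex Rpos κ + n / 2) * Real.Gamma (dunklIndex Rpos κ + n / 2 + 1) : ℝ) : 𝕜) := by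
  have : Nonempty (Fin d) := ⟨⟨0, hd⟩⟩
  set γ : ℝ := ∑ α ∈ Rpos, κ α with hγ
  have hγ0 : 0 ≤ γ := Finset.sum_nonneg hκ
  have hd' : (1 : ℝ) ≤ d := by exact_mod_cast hd
  have hmain := integral_eq_sphere_mul_radial (d := d)
    (fun x : E => gaussWeight Rpos κ 0 x • evalAt x p)
    (fun ω => evalAt (ω : E) p * ((dunklWeight Rpos κ (ω : E) ^ 2 : ℝ) : 𝕜))
    (fun r => r ^ (2 * γ + n) * Real.exp (-r ^ 2 / 2)) (by
      intro ω r hr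
      have hnorm : ‖r • (ω : E)‖ = r := by
        rw [norm_smul, Real.norm_of_nonneg hr.le, mem_sphere_zero_iff_norm.1 ω.2, mul_one]
      have hpow : r ^ (2 * γ + n) = (r ^ γ) ^ 2 * r ^ n := by
        rw [Real.rpow_add hr, Real.rpow_natCast, mul_comm 2 γ, Real.rpow_mul hr.le]
        norm_num
      rw [evalAt_smul_of_isHomogeneous hp, gaussWeight, regWeight_zero, dunklWeight_smul _ _ hr,
        hnorm, hpow, RCLike.real_smul_eq_coe_mul]
      push_cast
      ring)
  unfold gaussIntegral sphereIntegral
  rw [hmain]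
  congr 2
  have hidx : dunklIndex Rpos κ = γ + (d - 2) / 2 := rfl
  have hrad : ∫ r in Set.Ioi (0 : ℝ), r ^ (d - 1) * (r ^ (2 * γ + n) * Real.exp (-r ^ 2 / 2)) =
      ∫ r in Set.Ioi (0 : ℝ), r ^ (d - 1 + (2 * γ + n)) * Real.exp (-(1 / 2) * r ^ (2 : ℝ)) := by
    refine setIntegral_congr_fun measurableSet_Ioi fun r hr => ?_
    have hr : 0 < r := hr
    rw [← mul_assoc, ← Real.rpow_natCast, ← Real.rpow_add hr, Nat.cast_sub hd, Nat.cast_one,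
      Real.rpow_two]
    congr 2
    ring
  have hn : (0 : ℝ) ≤ n := n.cast_nonneg
  rw [hrad, integral_rpow_mul_exp_neg_mul_rpow two_pos (by linarith) one_half_pos]
  have e1 : ((d : ℝ) - 1 + (2 * γ + n) + 1) / 2 = dunklIndex Rpos κ + n / 2 + 1 := by
    rw [hidx]; ring
  have e2 : -((d : ℝ) - 1 + (2 * γ + n) + 1) / 2 = -(dunklIndex Rpos κ + n / 2 + 1) := by
    rw [hidx]; ring
  rw [e1, e2, one_div, Real.inv_rpow zero_le_two, Real.rpow_neg zero_le_two, inv_inv,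
    Real.rpow_add_one two_ne_zero]
  ring

theorem integral_dunklWeight_pos (hRpos : IsPositiveSystem R Rpos)
    (hκ : IsMultiplicityFunction R κ) :
    0 < ∫ x : E, dunklWeight Rpos κ x ^ 2 * Real.exp (-‖x‖ ^ 2 / 2) := by
  have hnn : ∀ β ∈ Rpos, 0 ≤ κ β := fun β hβ => hκ.nonneg β (hRpos.subset hβ)
  have heq : (fun x : E => dunklWeight Rpos κ x ^ 2 * Real.exp (-‖x‖ ^ 2 / 2)) =
      gaussWeight Rpos κ 0 := by
    ext x; rw [gaussWeight, regWeight_zero]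
  rw [heq]
  have hint : Integrable (gaussWeight Rpos κ 0) := by
    have := integrable_gauss (𝕜 := ℝ) hRpos hκ (1 : MvPolynomial (Fin d) ℝ)
    simpa [evalAt] using this
  rw [integral_pos_iff_support_of_nonneg (fun x => gaussWeight_nonneg _ _ le_rfl x) hint]
  refine (continuous_gaussWeight hnn 0).isOpen_support.measure_pos _ ?_
  obtain ⟨v, hv0, hv⟩ := id hRpos
  -- The vector defining the positive system pairs positively with every positive root, so the
  -- weight is positive there.
  refine ⟨v, ?_⟩
  rw [Function.mem_support]
  refine (mul_pos (Finset.prod_pos fun α hα => ?_) (Real.exp_pos _)).ne'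
  have := ((hv α).1 hα).2
  positivity

theorem gaussIntegral_one :
    gaussIntegral Rpos κ (1 : MvPolynomial (Fin d) 𝕜) =
      ((∫ x : E, dunklWeight Rpos κ x ^ 2 * Real.exp (-‖x‖ ^ 2 / 2) : ℝ) : 𝕜) := by
  rw [← integral_ofReal]
  unfold gaussIntegral
  refine integral_congr_ae (Eventually.of_forall fun x => ?_)
  simp [evalAt, gaussWeight, regWeight_zero, RCLike.real_smul_eq_coe_mul]

theorem sphereIntegral_add (hκ : ∀ α ∈ Rpos, 0 ≤ κ α) (p q : MvPolynomial (Fin d) 𝕜) :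
    sphereIntegral Rpos κ (p + q) = sphereIntegral Rpos κ p + sphereIntegral Rpos κ q := by
  have : IsFiniteMeasure (surfaceMeasure d) :=
    inferInstanceAs (IsFiniteMeasure (volume : Measure E).toSphere)
  have hi : ∀ p : MvPolynomial (Fin d) 𝕜, Integrable (fun x : Metric.sphere (0 : E) 1 =>
      evalAt (x : E) p * ((dunklWeight Rpos κ (x : E) ^ 2 : ℝ) : 𝕜)) (surfaceMeasure d) := by
    intro p
    have hc : Continuous (fun x : Metric.sphere (0 : E) 1 =>
        evalAt (x : E) p * ((dunklWeight Rpos κ (x : E) ^ 2 : ℝ) : 𝕜)) := by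
      simp only [← regWeight_zero]
      exact ((continuous_evalAt p).comp continuous_subtype_val).mul
        (RCLike.continuous_ofReal.comp ((continuous_regWeight hκ 0).comp continuous_subtype_val))
    exact hc.integrable_of_hasCompactSupport (HasCompactSupport.of_compactSpace _)
  unfold sphereIntegral
  rw [← integral_add (hi p) (hi q)]
  simp only [evalAt_add, add_mul]

/-! ### The Pizzetti series and the mean value property -/

/-- The coefficients of the expansion of the spherical mean in powers of the Dunkl Laplacian. -/
noncomputable def pizzettiCoeff (s : ℝ) (l : ℕ) : ℝ :=
  (2 : ℝ) ^ (-s) / (2 ^ (2 * l) * (l.factorial : ℝ) * Real.Gamma (s + l + 1))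

theorem hasSum_pizzetti_of_isHomogeneous (hd : 0 < d) (hR : IsReducedRootSystem R)
    (hRpos : IsPositiveSystem R Rpos) (hκ : IsMultiplicityFunction R κ)
    {p : MvPolynomial (Fin d) 𝕜} {n : ℕ} (hp : p.IsHomogeneous n) :
    HasSum (fun l : ℕ => (pizzettiCoeff (dunklIndex Rpos κ) l : 𝕜) *
        evalAt 0 ((dunklLaplacian Rpos κ)^[l] p))
      ((dunklConst Rpos κ : 𝕜) * sphereIntegral Rpos κ p) := by
  have hnn : ∀ β ∈ Rpos, 0 ≤ κ β := fun β hβ => hκ.nonneg β (hRpos.subset hβ)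
  have h0 := hRpos.ne_zero hR
  have hpolar := gaussIntegral_eq_sphereIntegral hd hnn hp
  have hs := dunklIndex_add_one_pos (Rpos := Rpos) hd hnn
  have hI := integral_dunklWeight_pos hRpos hκ
  have hn : (0 : ℝ) ≤ n := n.cast_nonneg
  set s := dunklIndex Rpos κ
  have hc : (0 : ℝ) < 2 ^ (s + n / 2) * Real.Gamma (s + n / 2 + 1) :=
    mul_pos (Real.rpow_pos_of_pos two_pos _) (Real.Gamma_pos_of_pos (by linarith))
  rcases Nat.even_or_odd' n with ⟨m, rfl | rfl⟩
  · have hval : (dunklConst Rpos κ : 𝕜) * sphereIntegral Rpos κ p =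
        (pizzettiCoeff s m : 𝕜) * evalAt 0 ((dunklLaplacian Rpos κ)^[m] p) := by
      have h := gaussIntegral_of_isHomogeneous_even hR hRpos hκ m hp
      rw [hpolar, gaussIntegral_one] at h
      rw [dunklConst]
      set I := ∫ x : E, dunklWeight Rpos κ x ^ 2 * Real.exp (-‖x‖ ^ 2 / 2)
      have hG : 0 < Real.Gamma (s + m + 1) := Real.Gamma_pos_of_pos (by
        have : (0 : ℝ) ≤ m := m.cast_nonneg
        linarith)
      -- One factor `2^m m!` comes from iterating `Δ_κ`, the other, `2^{s+m} Γ(s + m + 1)`, from the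
      -- radial integral.
      have hcoef : pizzettiCoeff s m =
          (2 ^ m * m.factorial * (2 ^ (s + (2 * m : ℕ) / 2) *
            Real.Gamma (s + (2 * m : ℕ) / 2 + 1)))⁻¹ := by
        have e : ((2 * m : ℕ) : ℝ) / 2 = m := by push_cast; ring
        rw [e, pizzettiCoeff, Real.rpow_add two_pos, Real.rpow_neg zero_le_two,
          Real.rpow_natCast, pow_mul', sq]
        field_simp
      have hI' : (I : 𝕜) ≠ 0 := by exact_mod_cast hI.ne'
      have hc' : ((2 ^ (s + (2 * m : ℕ) / 2) * Real.Gamma (s + (2 * m : ℕ) / 2 + 1) : ℝ) : 𝕜) ≠ 0 :=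
        by exact_mod_cast hc.ne'
      have hm' : (m.factorial : 𝕜) ≠ 0 := by exact_mod_cast m.factorial_ne_zero
      rw [hcoef, RCLike.ofReal_inv, RCLike.ofReal_inv, RCLike.ofReal_mul (2 ^ m * (m.factorial : ℝ))]
      generalize ((2 ^ (s + (2 * m : ℕ) / 2) * Real.Gamma (s + (2 * m : ℕ) / 2 + 1) : ℝ) : 𝕜) = c
        at h hc' ⊢
      push_cast
      field_simp
      linear_combination h
    rw [hval]
    refine hasSum_single m fun l hl => ?_
    rw [evalAt_zero_iterate_dunklLaplacian h0 hp (by omega), mul_zero]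
  · have hS : sphereIntegral Rpos κ p = 0 := by
      rw [gaussIntegral_of_isHomogeneous_odd hR hRpos hκ m hp] at hpolar
      refine (mul_eq_zero.1 hpolar.symm).resolve_right ?_
      exact_mod_cast hc.ne'
    rw [hS, mul_zero]
    convert hasSum_zero with l
    rw [evalAt_zero_iterate_dunklLaplacian h0 hp (by omega), mul_zero]

theorem hasSum_pizzetti (hd : 0 < d) (hR : IsReducedRootSystem R)
    (hRpos : IsPositiveSystem R Rpos) (hκ : IsMultiplicityFunction R κ)
    (p : MvPolynomial (Fin d) 𝕜) :
    HasSum (fun l : ℕ => (pizzettiCoeff (dunklIndex Rpos κ) l : 𝕜) *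
        evalAt 0 ((dunklLaplacian Rpos κ)^[l] p))
      ((dunklConst Rpos κ : 𝕜) * sphereIntegral Rpos κ p) := by
  rw [← sum_homogeneousComponent p]
  -- Freeing the number of components from the degree of `p` allows induction on partial sums.
  generalize p.totalDegree + 1 = N
  induction N with
  | zero =>
    simpa using hasSum_pizzetti_of_isHomogeneous hd hR hRpos hκ
      (isHomogeneous_zero (Fin d) 𝕜 0)
  | succ N ih =>
    rw [Finset.sum_range_succ]
    have h := ih.add (hasSum_pizzetti_of_isHomogeneous hd hR hRpos hκ
      (homogeneousComponent_isHomogeneous N p))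
    rw [← mul_add, ← sphereIntegral_add fun β hβ => hκ.nonneg β (hRpos.subset hβ)] at h
    simpa only [← mul_add, ← evalAt_add,
      ← iterate_dunklLaplacian_add (hRpos.ne_zero hR)] using h

theorem dunklConst_mul_sphereIntegral_of_dunklLaplacian_eq_zero (hd : 0 < d)
    (hR : IsReducedRootSystem R) (hRpos : IsPositiveSystem R Rpos)
    (hκ : IsMultiplicityFunction R κ) {p : MvPolynomial (Fin d) 𝕜}
    (hp : dunklLaplacian Rpos κ p = 0) :
    (dunklConst Rpos κ : 𝕜) * sphereIntegral Rpos κ p =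
      (pizzettiCoeff (dunklIndex Rpos κ) 0 : 𝕜) * evalAt 0 p := by
  refine (hasSum_pizzetti hd hR hRpos hκ p).unique (hasSum_single 0 fun l hl => ?_)
  obtain ⟨k, rfl⟩ := Nat.exists_eq_succ_of_ne_zero hl
  rw [Nat.succ_eq_add_one, Function.iterate_succ_apply, hp,
    iterate_dunklLaplacian_zero (hRpos.ne_zero hR)]
  simp [evalAt]

theorem sphereIntegral_one :
    sphereIntegral Rpos κ (1 : MvPolynomial (Fin d) 𝕜) = (sphereMass Rpos κ : 𝕜) := by
  rw [sphereMass, ← integral_ofReal]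
  simp [sphereIntegral, evalAt]

/-- Only the `l = 0` term survives for harmonic `p`. Applied to `p = 1` it evaluates `b_κ` times the
spherical mass; as the coefficient is nonzero, so are both factors, and division gives the mean
value. -/
theorem pizzetti_mean_value (hd : 0 < d)
    (hR : IsReducedRootSystem R) (hRpos : IsPositiveSystem R Rpos)
    (hκ : IsMultiplicityFunction R κ) {p : MvPolynomial (Fin d) 𝕜}
    (hp : dunklLaplacian Rpos κ p = 0) :
    ((sphereMass Rpos κ)⁻¹ : 𝕜) * sphereIntegral Rpos κ p = evalAt 0 p := by
  have h1 := dunklConst_mul_sphereIntegral_of_dunklLaplacian_eq_zero hd hR hRpos hκ hp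
  have h2 := dunklConst_mul_sphereIntegral_of_dunklLaplacian_eq_zero hd hR hRpos hκ
    (dunklLaplacian_C (κ := κ) (hRpos.ne_zero hR) (1 : 𝕜))
  rw [evalAt_C, map_one, mul_one, sphereIntegral_one] at h2
  have hs := dunklIndex_add_one_pos (Rpos := Rpos) hd
    fun β hβ => hκ.nonneg β (hRpos.subset hβ)
  have hc : (pizzettiCoeff (dunklIndex Rpos κ) 0 : 𝕜) ≠ 0 := by
    have : 0 < pizzettiCoeff (dunklIndex Rpos κ) 0 := by
      unfold pizzettiCoeff
      have := Real.Gamma_pos_of_pos hs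
      simp only [Nat.cast_zero, add_zero]
      positivity
    exact_mod_cast this.ne'
  rw [← h2] at h1 hc
  have hb := left_ne_zero_of_mul hc
  have hm := right_ne_zero_of_mul hc
  rw [mul_assoc] at h1
  rw [mul_left_cancel₀ hb h1, inv_mul_cancel_left₀ hm]

end

end DunklPizzetti

theorem corollary4p5 {𝕜 : Type*} [RCLike 𝕜] {d : ℕ} (hd : 0 < d)
    (R Rpos : Finset (EuclideanSpace ℝ (Fin d)))
    (hR : DunklPizzetti.IsReducedRootSystem R)
    (hRpos : DunklPizzetti.IsPositiveSystem R Rpos)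
    (κ : EuclideanSpace ℝ (Fin d) → ℝ)
    (hκ : DunklPizzetti.IsMultiplicityFunction R κ)
    (p : MvPolynomial (Fin d) 𝕜) :
    HasSum
      (fun l : ℕ =>
        (((2 : ℝ) ^ (-DunklPizzetti.dunklIndex Rpos κ) /
          (2 ^ (2 * l) * (l.factorial : ℝ) *
            Real.Gamma (DunklPizzetti.dunklIndex Rpos κ + l + 1)) : ℝ) : 𝕜) *
          DunklPizzetti.evalAt 0 ((DunklPizzetti.dunklLaplacian Rpos κ)^[l] p))
      ((DunklPizzetti.dunklConst Rpos κ : 𝕜) * DunklPizzetti.sphereIntegral Rpos κ p) ∧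
    (DunklPizzetti.dunklLaplacian Rpos κ p = 0 →
      ((DunklPizzetti.sphereMass Rpos κ)⁻¹ : 𝕜) * DunklPizzetti.sphereIntegral Rpos κ p =
        DunklPizzetti.evalAt 0 p) :=
  ⟨DunklPizzetti.hasSum_pizzetti hd hR hRpos hκ p,
    fun hp => DunklPizzetti.pizzetti_mean_value hd hR hRpos hκ hp⟩
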